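/- Let $D \in \mathbb{N}$, $r \ge 0$, $\mathcal{X} = [0,r]^D$, and let $f \sim \mathcal{GP}(0,k)$ be a centered real-valued Gaussian process indexed by $\mathcal{X}$ with covariance function $k : \mathcal{X} \times \mathcal{X} \to \mathbb{R}$, defined on some probability space. Assume that $f$ is separable, as is the case when its paths are almost surely continuous: there is a countable set $S \subseteq \mathcal{X}$ such that, almost surely, for every $x \in \mathcal{X}$ the point $(x, f(x))$ lies in the closure of $\{(s, f(s)) : s \in S\}$ in $\mathcal{X} \times \mathbb{R}$. Suppose that $k$ is $L_k$-Lipschitz with a constant $L_k \ge 0$, in the sense that $$|k(x,x) - k(x,x')| \le L_k \|x - x'\|_\infty \qquad \text{for all } x, x' \in \mathcal{X},$$ and let $\sigma \ge 0$ be given by $\sigma^2 = \max_{x \in \mathcal{X}} k(x,x)$. Then $\sup_{x \in \mathcal{X}} f(x)$ is almost surely finite and integrable, and $$\mathbb{E}\Big[\sup_{x \in \mathcal{X}} f(x)\Big] \le 12\, \sigma \sqrt{2D + D \log\big(1 + 4 L_k r \sigma^{-2}\big)},$$ where the right-hand side is read as $0$ if $\sigma = 0$. -/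

import Mathlib

open MeasureTheory ProbabilityTheory Set

/-- The cube `[0, r]^D`. As a subset of `Fin D → ℝ` it carries the sup norm. -/
abbrev cube (D : ℕ) (r : ℝ) : Set (Fin D → ℝ) :=
  Set.Icc 0 (fun _ => r)

/-- `f ∼ GP(0, k)` under `P`: the real-valued process `f` is Gaussian (all finite-dimensional
distributions are Gaussian), centered, and has covariance function `k`. -/
structure IsCenteredGP {Ω T : Type*} [MeasurableSpace Ω]
    (f : T → Ω → ℝ) (k : T → T → ℝ) (P : Measure Ω) : Prop where
  gaussian : IsGaussianProcess f P
  centered : ∀ x, ∫ ω, f x ω ∂P = 0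
  covariance_eq : ∀ x y, cov[f x, f y; P] = k x y

/-- Separability of a process in the sense of Doob: for some countable set `S` of indices,
almost every path has a graph contained in the closure of the graph of its restriction to `S`.
Every process on a separable metric space with almost surely continuous paths is separable. -/
def IsSeparableProcess {Ω T : Type*} [MeasurableSpace Ω] [TopologicalSpace T]
    (f : T → Ω → ℝ) (P : Measure Ω) : Prop :=
  ∃ S : Set T, S.Countable ∧
    ∀ᵐ ω ∂P, ∀ x : T, (x, f x ω) ∈ closure ((fun s : T => (s, f s ω)) '' S)

/-! Dudley's chaining. The canonical metric d(x,y)² = Var(f x - f y) is at most 2L‖x - y‖, so a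
sup-norm grid of mesh proportional to 4⁻ⁿ is a σ2⁻ⁿ-net for d, and its log-cardinality is at most
(n+1)K with K = 2D + D log(1 + 4Lrσ⁻²). Passing from net n to net n+1 costs at most σ2⁻ⁿ√(2(n+2)K)
by the sub-Gaussian maximal inequality. The costs sum to at most 5σ√(2K) ≤ 12σ√K, uniformly over
finite index sets (`integral_sup'_le_of_nets`). Monotone convergence extends the bound to sequences
and yields almost sure finiteness; separability extends it to the cube
(`IsSeparableProcess.integral_iSup_le`). -/

open scoped NNReal

/-! ### Sub-Gaussian maximal inequality -/

/-- A centered Gaussian random variable is sub-Gaussian with any constant above its variance. -/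
theorem hasSubgaussianMGF_of_hasGaussianLaw {Ω : Type*} [MeasurableSpace Ω] {P : Measure Ω}
    {X : Ω → ℝ} (h : HasGaussianLaw X P) (hmean : ∫ ω, X ω ∂P = 0)
    {c : ℝ≥0} (hvar : Var[X; P] ≤ c) : HasSubgaussianMGF X c P where
  integrable_exp_mul t := by
    have hX : AEMeasurable X P := h.aemeasurable
    have := integrable_exp_mul_gaussianReal (μ := P[X]) (v := Var[X; P].toNNReal) t
    rw [← h.map_eq_gaussianReal] at this
    exact (integrable_map_measure (by fun_prop) hX).1 this
  mgf_le t := by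
    rw [mgf_gaussianReal h.map_eq_gaussianReal, hmean, Real.coe_toNNReal _ (variance_nonneg _ _)]
    gcongr
    simp only [zero_mul, zero_add]
    gcongr

/-- Optimisation of the Chernoff parameter: take t = x / s², or t large when s = 0. -/
theorem le_mul_sqrt_of_forall_mul_le {x s B : ℝ} (hs : 0 ≤ s) (hB : 0 ≤ B)
    (h : ∀ t : ℝ, 0 < t → t * x ≤ B + s ^ 2 * t ^ 2 / 2) : x ≤ s * √(2 * B) := by
  by_contra! hx
  have h0 : 0 ≤ s * √(2 * B) := by positivity
  have hx0 : 0 < x := h0.trans_lt hx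
  rcases hs.eq_or_lt with rfl | hs'
  · have := h ((B + 1) / x) (by positivity)
    rw [div_mul_cancel₀ _ hx0.ne'] at this
    simp at this
    linarith
  · have h1 := h (x / s ^ 2) (by positivity)
    have h2 : x ^ 2 ≤ s ^ 2 * (2 * B) := by
      have e1 : x / s ^ 2 * x = x ^ 2 / s ^ 2 := by ring
      have e2 : s ^ 2 * (x / s ^ 2) ^ 2 / 2 = x ^ 2 / s ^ 2 / 2 := by field_simp
      rw [e1, e2] at h1
      have : x ^ 2 / s ^ 2 ≤ 2 * B := by linarith
      rwa [div_le_iff₀ (by positivity), mul_comm] at this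
    have h3 : (s * √(2 * B)) ^ 2 = s ^ 2 * (2 * B) := by
      rw [mul_pow, Real.sq_sqrt (by positivity)]
    have := pow_lt_pow_left₀ hx h0 two_ne_zero
    linarith

theorem integrable_finset_sup' {Ω ι : Type*} [MeasurableSpace Ω] {P : Measure Ω}
    {X : ι → Ω → ℝ} {F : Finset ι} (hF : F.Nonempty) (hX : ∀ i ∈ F, Integrable (X i) P) :
    Integrable (fun ω => F.sup' hF fun i => X i ω) P := by
  have : Integrable (F.sup' hF X) P :=
    Finset.sup'_induction hF X (p := fun g => Integrable g P) (fun _ h _ h' => h.sup h') hX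
  convert this using 1
  ext ω
  rw [Finset.sup'_apply]

/-- Maximal inequality for finitely many sub-Gaussian random variables. -/
theorem integral_sup'_le_of_hasSubgaussianMGF {Ω ι : Type*} [MeasurableSpace Ω] {P : Measure Ω}
    [IsProbabilityMeasure P] {X : ι → Ω → ℝ} {F : Finset ι} (hF : F.Nonempty) {s : ℝ≥0}
    (hX : ∀ i ∈ F, HasSubgaussianMGF (X i) (s ^ 2) P) {B : ℝ} (hB : Real.log F.card ≤ B) :
    ∫ ω, F.sup' hF (fun i => X i ω) ∂P ≤ s * √(2 * B) := by
  have hN : (0 : ℝ) < F.card := by exact_mod_cast hF.card_pos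
  have hN1 : (1 : ℝ) ≤ F.card := by exact_mod_cast hF.card_pos
  refine le_mul_sqrt_of_forall_mul_le s.2 ((Real.log_nonneg hN1).trans hB) fun t ht => ?_
  have hint := integrable_finset_sup' hF fun i hi => (hX i hi).integrable
  -- `a` is the log of the bound on E ∑ exp(t Xᵢ). The tangent to exp at `a`, u ≤ a - 1 + exp(u -
  -- a), replaces Jensen's inequality and integrates to t E max ≤ a.
  set a : ℝ := Real.log F.card + s ^ 2 * t ^ 2 / 2 with ha
  have hpt : ∀ ω, t * F.sup' hF (fun i => X i ω) ≤
      a - 1 + Real.exp (-a) * ∑ i ∈ F, Real.exp (t * X i ω) := by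
    intro ω
    obtain ⟨i, hi, hmax⟩ := F.exists_mem_eq_sup' hF fun i => X i ω
    rw [hmax]
    have h1 := Real.add_one_le_exp (t * X i ω - a)
    have h2 : Real.exp (t * X i ω) ≤ ∑ i ∈ F, Real.exp (t * X i ω) :=
      Finset.single_le_sum (f := fun i => Real.exp (t * X i ω)) (fun _ _ => by positivity) hi
    have h3 : Real.exp (t * X i ω - a) = Real.exp (-a) * Real.exp (t * X i ω) := by
      rw [← Real.exp_add]; ring_nf
    have h4 := mul_le_mul_of_nonneg_left h2 (Real.exp_pos (-a)).le
    linarith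
  have hsum : Integrable (fun ω => ∑ i ∈ F, Real.exp (t * X i ω)) P :=
    integrable_finsetSum _ fun i hi => (hX i hi).integrable_exp_mul t
  have hle : ∫ ω, ∑ i ∈ F, Real.exp (t * X i ω) ∂P ≤ Real.exp a := by
    rw [integral_finsetSum _ fun i hi => (hX i hi).integrable_exp_mul t, ha, Real.exp_add,
      Real.exp_log hN, ← nsmul_eq_mul]
    refine Finset.sum_le_card_nsmul _ _ _ fun i hi => ?_
    simpa [mgf] using (hX i hi).mgf_le t
  have key := integral_mono (hint.const_mul t)
    ((integrable_const (a - 1)).add (hsum.const_mul (Real.exp (-a)))) hpt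
  simp only [Pi.add_apply] at key
  rw [integral_const_mul, integral_add (integrable_const _) (hsum.const_mul _),
    integral_const_mul] at key
  have h5 := mul_le_mul_of_nonneg_left hle (Real.exp_pos (-a)).le
  rw [← Real.exp_add, neg_add_cancel, Real.exp_zero] at h5
  simp only [integral_const, probReal_univ, one_smul] at key
  linarith

/-! ### Chaining -/

/-- One chaining step: passing from a finite index set to a finite set `s`-close to it. -/
theorem integral_sup'_le_add_of_increments {Ω ι : Type*} [MeasurableSpace Ω] {P : Measure Ω}
    [IsProbabilityMeasure P] {X : ι → Ω → ℝ} {F G : Finset ι} (hF : F.Nonempty) (hG : G.Nonempty)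
    (hX : ∀ i, Integrable (X i) P) {s : ℝ≥0}
    (hFG : ∀ i ∈ F, ∃ j ∈ G, HasSubgaussianMGF (fun ω => X i ω - X j ω) (s ^ 2) P)
    {B : ℝ} (hB : Real.log F.card ≤ B) :
    ∫ ω, F.sup' hF (fun i => X i ω) ∂P ≤
      ∫ ω, G.sup' hG (fun i => X i ω) ∂P + s * √(2 * B) := by
  have : ∀ i, ∃ j, i ∈ F → j ∈ G ∧ HasSubgaussianMGF (fun ω => X i ω - X j ω) (s ^ 2) P := by
    intro i
    by_cases hi : i ∈ F
    · obtain ⟨j, hj⟩ := hFG i hi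
      exact ⟨j, fun _ => hj⟩
    · exact ⟨i, fun h => absurd h hi⟩
  choose p hp using this
  have h1 : Integrable (fun ω => G.sup' hG fun i => X i ω) P :=
    integrable_finset_sup' hG fun i _ => hX i
  have h2 : Integrable (fun ω => F.sup' hF fun i => X i ω - X (p i) ω) P :=
    integrable_finset_sup' hF fun i _ => (hX i).sub (hX (p i))
  calc ∫ ω, F.sup' hF (fun i => X i ω) ∂P
      ≤ ∫ ω, (G.sup' hG (fun i => X i ω) + F.sup' hF (fun i => X i ω - X (p i) ω)) ∂P := by
        refine integral_mono (integrable_finset_sup' hF fun i _ => hX i) (h1.add h2) fun ω => ?_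
        refine Finset.sup'_le _ _ fun i hi => ?_
        have e1 := Finset.le_sup' (fun i => X i ω) (hp i hi).1
        have e2 := Finset.le_sup' (fun i => X i ω - X (p i) ω) hi
        simp only at e1 e2 ⊢
        linarith
    _ = ∫ ω, G.sup' hG (fun i => X i ω) ∂P +
        ∫ ω, F.sup' hF (fun i => X i ω - X (p i) ω) ∂P := integral_add h1 h2
    _ ≤ _ := by
        gcongr
        exact integral_sup'_le_of_hasSubgaussianMGF hF (fun i hi => (hp i hi).2) hB

/-- Dudley's chaining bound along nets of radius `σ 2⁻ⁿ` whose log-cardinalities grow at most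
linearly. -/
theorem integral_sup'_le_of_nets {Ω ι : Type*} [MeasurableSpace Ω] {P : Measure Ω}
    [IsProbabilityMeasure P] {X : ι → Ω → ℝ} {σ : ℝ≥0}
    (hX : ∀ i, HasSubgaussianMGF (X i) (σ ^ 2) P) {K : ℝ}
    (T : ℕ → Finset ι) (hT : ∀ n, (T n).Nonempty)
    (hcard : ∀ n, Real.log (T n).card ≤ (n + 1) * K)
    (hnet : ∀ n i, ∃ j ∈ T n, HasSubgaussianMGF (fun ω => X i ω - X j ω) ((σ / 2 ^ n) ^ 2) P)
    {F : Finset ι} (hF : F.Nonempty) :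
    ∫ ω, F.sup' hF (fun i => X i ω) ∂P ≤ 5 * (σ * √(2 * K)) := by
  have hint i : Integrable (X i) P := (hX i).integrable
  have hq : 0 ≤ σ * √(2 * K) := by positivity
  -- The coefficient starts at 1 and grows by (n+3)/2ⁿ⁺¹ per level, since √(n+2) ≤ (n+3)/2 by AM-GM;
  -- its limit is 5.
  have hlevel : ∀ n : ℕ, ∫ ω, (T n).sup' (hT n) (fun i => X i ω) ∂P ≤
      (5 - (n + 4) / 2 ^ n) * (σ * √(2 * K)) := by
    intro n
    induction n with
    | zero =>
      have := integral_sup'_le_of_hasSubgaussianMGF (hT 0) (fun i _ => hX i) (hcard 0)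
      simp only [CharP.cast_eq_zero, zero_add, one_mul, pow_zero, div_one] at this ⊢
      linarith
    | succ n ih =>
      have hstep := integral_sup'_le_add_of_increments (hT (n + 1)) (hT n) hint
        (fun i _ => hnet n i) (hcard (n + 1))
      have hsq : √(2 * (((n + 1 : ℕ) + 1) * K)) ≤ ((n : ℝ) + 3) / 2 * √(2 * K) := by
        rw [show 2 * ((((n + 1 : ℕ) : ℝ) + 1) * K) = ((n : ℝ) + 2) * (2 * K) by push_cast; ring,
          Real.sqrt_mul (by positivity)]
        gcongr
        rw [Real.sqrt_le_left (by positivity)]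
        nlinarith [sq_nonneg ((n : ℝ) + 1)]
      have hmul : ((σ / 2 ^ n : ℝ≥0) : ℝ) * √(2 * (((n + 1 : ℕ) + 1) * K)) ≤
          (σ / 2 ^ n : ℝ) * (((n : ℝ) + 3) / 2 * √(2 * K)) := by
        push_cast at hsq ⊢
        gcongr
      calc _ ≤ _ := hstep
        _ ≤ (5 - (n + 4) / 2 ^ n) * (σ * √(2 * K)) +
            (σ / 2 ^ n : ℝ) * (((n : ℝ) + 3) / 2 * √(2 * K)) := add_le_add ih hmul
        _ = _ := by
          push_cast
          rw [pow_succ]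
          field_simp
          ring
  -- `F` is linked directly to net n; as `F` is fixed, this last link vanishes as n → ∞.
  have hbound : ∀ n : ℕ, ∫ ω, F.sup' hF (fun i => X i ω) ∂P ≤
      5 * (σ * √(2 * K)) + σ * √(2 * Real.log F.card) * (1 / 2) ^ n := by
    intro n
    have h1 := integral_sup'_le_add_of_increments hF (hT n) hint (fun i _ => hnet n i) le_rfl
    have h2 : (5 - ((n : ℝ) + 4) / 2 ^ n) * (σ * √(2 * K)) ≤ 5 * (σ * √(2 * K)) := by
      gcongr
      have : 0 ≤ ((n : ℝ) + 4) / 2 ^ n := by positivity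
      linarith
    have h3 : ((σ / 2 ^ n : ℝ≥0) : ℝ) * √(2 * Real.log F.card) =
        σ * √(2 * Real.log F.card) * (1 / 2) ^ n := by
      push_cast
      rw [one_div, inv_pow]
      ring
    linarith [hlevel n]
  have hlim : Filter.Tendsto
      (fun n : ℕ => 5 * (σ * √(2 * K)) + σ * √(2 * Real.log F.card) * (1 / 2) ^ n)
      Filter.atTop (nhds (5 * (σ * √(2 * K)))) := by
    have := (tendsto_pow_atTop_nhds_zero_of_lt_one (r := (1 / 2 : ℝ))
      (by norm_num) (by norm_num)).const_mul (σ * √(2 * Real.log F.card))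
    simpa using this.const_add (5 * (σ * √(2 * K)))
  exact ge_of_tendsto' hlim hbound

/-! ### From finite maxima to the full supremum -/

/-- A sequence whose finite maxima have expectations bounded by `C` has an almost surely finite,
integrable supremum of expectation at most `C`. -/
theorem integral_iSup_le_of_forall_integral_sup'_le {Ω : Type*} [MeasurableSpace Ω]
    {P : Measure Ω} {X : ℕ → Ω → ℝ} (hX : ∀ n, Integrable (X n) P) {C : ℝ}
    (hC : ∀ (F : Finset ℕ) (hF : F.Nonempty), ∫ ω, F.sup' hF (fun i => X i ω) ∂P ≤ C) :
    (∀ᵐ ω ∂P, BddAbove (range fun n => X n ω)) ∧ Integrable (fun ω => ⨆ n, X n ω) P ∧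
      ∫ ω, ⨆ n, X n ω ∂P ≤ C := by
  have hne (n : ℕ) : (Finset.range (n + 1)).Nonempty := Finset.nonempty_range_add_one
  set M : ℕ → Ω → ℝ := fun n ω => (Finset.range (n + 1)).sup' (hne n) fun i => X i ω
  have hMint (n : ℕ) : Integrable (M n) P := integrable_finset_sup' (hne n) fun i _ => hX i
  have hXM (n : ℕ) (ω : Ω) : X n ω ≤ M n ω :=
    Finset.le_sup' (fun i => X i ω) (Finset.self_mem_range_succ n)
  -- Subtracting `X 0` makes the increasing maxima nonnegative, as monotone convergence for
  -- `lintegral` needs.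
  have hX0M (n : ℕ) (ω : Ω) : 0 ≤ M n ω - X 0 ω :=
    sub_nonneg.2 (Finset.le_sup' (fun i => X i ω) (Finset.mem_range.2 n.succ_pos))
  set g : ℕ → Ω → ENNReal := fun n ω => ENNReal.ofReal (M n ω - X 0 ω)
  set c : ℝ := C - ∫ ω, X 0 ω ∂P with hc
  have hMC (n : ℕ) : ∫ ω, (M n ω - X 0 ω) ∂P ≤ c := by
    rw [integral_sub (hMint n) (hX 0)]
    exact sub_le_sub_right (hC _ (hne n)) _
  have hc0 : 0 ≤ c := (integral_nonneg (hX0M 0)).trans (hMC 0)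
  have hgmeas (n : ℕ) : AEMeasurable (g n) P :=
    ((hMint n).sub (hX 0)).aemeasurable.ennreal_ofReal
  have hlint : ∫⁻ ω, ⨆ n, g n ω ∂P ≤ ENNReal.ofReal c := by
    rw [lintegral_iSup' hgmeas]
    · refine iSup_le fun n => ?_
      exact (ofReal_integral_eq_lintegral_ofReal ((hMint n).sub (hX 0))
        (Filter.Eventually.of_forall (hX0M n))).symm.trans_le (ENNReal.ofReal_le_ofReal (hMC n))
    · refine Filter.Eventually.of_forall fun ω m n hmn => ENNReal.ofReal_le_ofReal ?_
      have : M m ω ≤ M n ω := Finset.sup'_mono _ (Finset.range_mono (by lia)) (hne m)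
      linarith
  have hfin : ∀ᵐ ω ∂P, ⨆ n, g n ω < ⊤ :=
    ae_lt_top' (AEMeasurable.iSup hgmeas) (hlint.trans_lt ENNReal.ofReal_lt_top).ne
  have hle : ∀ᵐ ω ∂P, ∀ n, X n ω ≤ X 0 ω + (⨆ n, g n ω).toReal := by
    filter_upwards [hfin] with ω hω n
    have h1 : M n ω - X 0 ω ≤ (⨆ n, g n ω).toReal := by
      rw [← ENNReal.ofReal_le_iff_le_toReal hω.ne]
      exact le_iSup (fun n => g n ω) n
    linarith [hXM n ω]
  have hbdd : ∀ᵐ ω ∂P, BddAbove (range fun n => X n ω) := by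
    filter_upwards [hle] with ω hω
    exact ⟨_, forall_mem_range.2 hω⟩
  have hnonneg : 0 ≤ᵐ[P] fun ω => (⨆ n, X n ω) - X 0 ω := by
    filter_upwards [hbdd] with ω hω
    exact sub_nonneg.2 (le_ciSup hω 0)
  have hmeas : AEStronglyMeasurable (fun ω => (⨆ n, X n ω) - X 0 ω) P :=
    ((AEMeasurable.iSup fun n => (hX n).aemeasurable).sub (hX 0).aemeasurable).aestronglyMeasurable
  have hlint' : ∫⁻ ω, ENNReal.ofReal ((⨆ n, X n ω) - X 0 ω) ∂P ≤ ENNReal.ofReal c := by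
    refine le_trans (lintegral_mono_ae ?_) hlint
    filter_upwards [hle, hfin] with ω hω hω'
    rw [ENNReal.ofReal_le_iff_le_toReal hω'.ne, sub_le_iff_le_add']
    exact ciSup_le hω
  have hint : Integrable (fun ω => (⨆ n, X n ω) - X 0 ω) P :=
    ⟨hmeas, (hasFiniteIntegral_iff_ofReal hnonneg).2 (hlint'.trans_lt ENNReal.ofReal_lt_top)⟩
  have hint' : Integrable (fun ω => ⨆ n, X n ω) P := by
    simpa [Pi.add_def] using hint.add (hX 0)
  refine ⟨hbdd, hint', ?_⟩
  have h1 : ∫ ω, ((⨆ n, X n ω) - X 0 ω) ∂P ≤ c := by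
    rw [integral_eq_lintegral_of_nonneg_ae hnonneg hmeas]
    exact ENNReal.toReal_le_of_le_ofReal hc0 hlint'
  rw [integral_sub hint' (hX 0)] at h1
  linarith

/-- An upper bound is a closed condition on points of the graph, so it passes from S to the closure.
`NeZero P` provides a good path, hence S ≠ ∅. -/
theorem exists_seq_of_isSeparableProcess {Ω T : Type*} [MeasurableSpace Ω] [TopologicalSpace T]
    [Nonempty T] {f : T → Ω → ℝ} {P : Measure Ω} [NeZero P] (h : IsSeparableProcess f P) :
    ∃ s : ℕ → T, ∀ᵐ ω ∂P, ∀ b, (∀ n, f (s n) ω ≤ b) → ∀ x, f x ω ≤ b := by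
  obtain ⟨S, hS, hclos⟩ := h
  have hSne : S.Nonempty := by
    obtain ⟨ω, hω⟩ := hclos.exists
    have := closure_nonempty_iff.1 ⟨_, hω (Classical.arbitrary T)⟩
    exact this.of_image
  obtain ⟨s, rfl⟩ := hS.exists_eq_range hSne
  refine ⟨s, ?_⟩
  filter_upwards [hclos] with ω hω b hb x
  have hcl : IsClosed {p : T × ℝ | p.2 ≤ b} := isClosed_le continuous_snd continuous_const
  refine closure_minimal ?_ hcl (hω x)
  rintro _ ⟨_, ⟨n, rfl⟩, rfl⟩
  exact hb n

/-- The supremum of a separable process inherits a uniform bound on its finite maxima. -/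
theorem IsSeparableProcess.integral_iSup_le {Ω T : Type*} [MeasurableSpace Ω]
    [TopologicalSpace T] [Nonempty T] {f : T → Ω → ℝ} {P : Measure Ω} [NeZero P]
    (h : IsSeparableProcess f P) (hf : ∀ x, Integrable (f x) P) {C : ℝ}
    (hC : ∀ (F : Finset T) (hF : F.Nonempty), ∫ ω, F.sup' hF (fun x => f x ω) ∂P ≤ C) :
    (∀ᵐ ω ∂P, BddAbove (range fun x => f x ω)) ∧ Integrable (fun ω => ⨆ x, f x ω) P ∧
      ∫ ω, ⨆ x, f x ω ∂P ≤ C := by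
  classical
  obtain ⟨s, hs⟩ := exists_seq_of_isSeparableProcess h
  obtain ⟨hbdd, hint, hle⟩ := integral_iSup_le_of_forall_integral_sup'_le (P := P)
    (X := fun n => f (s n)) (fun n => hf (s n)) (C := C) fun F hF => by
      have := hC (F.image s) (hF.image s)
      simpa [Finset.sup'_image, Function.comp_def] using this
  have hbdd' : ∀ᵐ ω ∂P, BddAbove (range fun x => f x ω) := by
    filter_upwards [hs, hbdd] with ω h1 ⟨b, hb⟩
    exact ⟨b, forall_mem_range.2 (h1 b fun n => hb (mem_range_self n))⟩
  have heq : (fun ω => ⨆ n, f (s n) ω) =ᵐ[P] fun ω => ⨆ x, f x ω := by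
    filter_upwards [hs, hbdd, hbdd'] with ω h1 h2 h3
    exact le_antisymm (ciSup_le fun n => le_ciSup h3 (s n))
      (ciSup_le (h1 _ fun n => le_ciSup h2 n))
  exact ⟨hbdd', hint.congr heq, (integral_congr_ae heq).symm.trans_le hle⟩

/-! ### Nets in the cube -/

/-- The cube `[0, r]^D` has an `r / m`-net of at most `m ^ D` points in the sup norm. -/
theorem exists_net_cube (D : ℕ) {r : ℝ} (hr : 0 ≤ r) {m : ℕ} (hm : 0 < m) :
    ∃ T : Finset (cube D r), T.Nonempty ∧ T.card ≤ m ^ D ∧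
      ∀ x : cube D r, ∃ y ∈ T, ‖(x : Fin D → ℝ) - (y : Fin D → ℝ)‖ ≤ r / m := by
  classical
  have hm' : (0 : ℝ) < m := by exact_mod_cast hm
  let p : (Fin D → Fin m) → cube D r := fun j =>
    ⟨fun d => j d * (r / m), fun d => by simp only [Pi.zero_apply]; positivity, fun d => by
      have : ((j d : ℕ) : ℝ) ≤ m := by exact_mod_cast (j d).2.le
      calc (j d : ℝ) * (r / m) ≤ m * (r / m) := by gcongr
        _ = r := by field_simp⟩
  have hcoord (t : ℝ) (h0 : 0 ≤ t) (h1 : t ≤ r) :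
      ∃ j : Fin m, |t - (j : ℝ) * (r / m)| ≤ r / m := by
    rcases hr.eq_or_lt with rfl | hr'
    · exact ⟨⟨0, hm⟩, by simp [le_antisymm h1 h0]⟩
    set δ : ℝ := r / m with hδ
    have hδ0 : 0 < δ := by positivity
    have hu : t / δ ≤ m := by
      rw [div_le_iff₀ hδ0, hδ]; field_simp; exact h1
    have hceil : ⌈t / δ⌉₊ ≤ m := Nat.ceil_le.2 hu
    -- The ceiling minus one, unlike the floor, stays below `m` at t = r; at t = 0 truncated
    -- subtraction gives 0.
    refine ⟨⟨⌈t / δ⌉₊ - 1, by lia⟩, ?_⟩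
    have ht : t / δ * δ = t := div_mul_cancel₀ _ hδ0.ne'
    have hup : t ≤ ⌈t / δ⌉₊ * δ := by
      rw [← ht]; gcongr; rw [ht]; exact Nat.le_ceil _
    have hlow : (⌈t / δ⌉₊ : ℝ) * δ ≤ t + δ := by
      have := (Nat.ceil_lt_add_one (show 0 ≤ t / δ by positivity)).le
      calc (⌈t / δ⌉₊ : ℝ) * δ ≤ (t / δ + 1) * δ := by gcongr
        _ = t + δ := by rw [add_mul, ht, one_mul]
    rcases Nat.eq_zero_or_pos ⌈t / δ⌉₊ with h | h
    · rw [h] at hup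
      have : t = 0 := le_antisymm (by simpa using hup) h0
      simp [this, hδ0.le]
    · rw [Nat.cast_sub h, sub_mul, abs_le]
      constructor <;> push_cast <;> linarith
  refine ⟨Finset.univ.image p, ⟨p fun _ => ⟨0, hm⟩, by simp⟩, ?_, fun x => ?_⟩
  · refine Finset.card_image_le.trans ?_
    simp
  · choose j hj using fun d => hcoord ((x : Fin D → ℝ) d) (x.2.1 d) (x.2.2 d)
    refine ⟨p j, Finset.mem_image_of_mem _ (Finset.mem_univ _), ?_⟩
    rw [pi_norm_le_iff_of_nonneg (by positivity)]
    exact hj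

/-! ### Gaussian processes with Lipschitz covariance -/

theorem IsCenteredGP.integrable {Ω T : Type*} [MeasurableSpace Ω] {f : T → Ω → ℝ}
    {k : T → T → ℝ} {P : Measure Ω} (hf : IsCenteredGP f k P) (x : T) : Integrable (f x) P :=
  (hf.gaussian.hasGaussianLaw_eval x).integrable

theorem IsCenteredGP.variance_eq {Ω T : Type*} [MeasurableSpace Ω] {f : T → Ω → ℝ}
    {k : T → T → ℝ} {P : Measure Ω} (hf : IsCenteredGP f k P) (x : T) : Var[f x; P] = k x x := by
  rw [← hf.covariance_eq, covariance_self (hf.gaussian.aemeasurable x)]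

theorem IsCenteredGP.hasSubgaussianMGF {Ω T : Type*} [MeasurableSpace Ω] {f : T → Ω → ℝ}
    {k : T → T → ℝ} {P : Measure Ω} (hf : IsCenteredGP f k P) {x : T} {c : ℝ≥0}
    (h : k x x ≤ c) : HasSubgaussianMGF (f x) c P :=
  hasSubgaussianMGF_of_hasGaussianLaw (hf.gaussian.hasGaussianLaw_eval x) (hf.centered x)
    (by rwa [hf.variance_eq])

/-- Var(f x - f y) is split into two differences, each of the form controlled by the Lipschitz
condition. -/
theorem IsCenteredGP.hasSubgaussianMGF_sub {Ω T : Type*} [MeasurableSpace Ω] {f : T → Ω → ℝ}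
    {k : T → T → ℝ} {P : Measure Ω} (hf : IsCenteredGP f k P) {x y : T} {c : ℝ≥0}
    (h : (k x x - k x y) + (k y y - k y x) ≤ c) :
    HasSubgaussianMGF (fun ω => f x ω - f y ω) c P := by
  have := hf.gaussian.isProbabilityMeasure
  refine hasSubgaussianMGF_of_hasGaussianLaw hf.gaussian.hasGaussianLaw_fun_sub ?_ ?_
  · rw [integral_sub (hf.integrable x) (hf.integrable y), hf.centered, hf.centered, sub_zero]
  · rw [variance_fun_sub (hf.gaussian.hasGaussianLaw_eval x).memLp_two
      (hf.gaussian.hasGaussianLaw_eval y).memLp_two, hf.variance_eq, hf.variance_eq,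
      hf.covariance_eq]
    have : k y x = k x y := by rw [← hf.covariance_eq, ← hf.covariance_eq, covariance_comm]
    linarith

/-- Expected maxima over finite subsets of the cube, for a nonzero maximal variance. -/
theorem IsCenteredGP.integral_sup'_cube_le {Ω : Type*} [MeasurableSpace Ω] {P : Measure Ω}
    {D : ℕ} {r : ℝ} (hr : 0 ≤ r) {f : cube D r → Ω → ℝ} {k : cube D r → cube D r → ℝ}
    (hf : IsCenteredGP f k P) {L : ℝ} (hL : 0 ≤ L)
    (hLip : ∀ x x' : cube D r,
      |k x x - k x x'| ≤ L * ‖(x : Fin D → ℝ) - (x' : Fin D → ℝ)‖)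
    {σ : ℝ≥0} (hσ : 0 < σ) (hmax : ∀ x, k x x ≤ (σ : ℝ) ^ 2)
    {F : Finset (cube D r)} (hF : F.Nonempty) :
    ∫ ω, F.sup' hF (fun x => f x ω) ∂P ≤
      5 * (σ * √(2 * (2 * D + D * Real.log (1 + 4 * L * r * (σ : ℝ) ^ (-2 : ℤ))))) := by
  have := hf.gaussian.isProbabilityMeasure
  have hσ' : (0 : ℝ) < σ := hσ
  set A : ℝ := L * r * (σ : ℝ) ^ (-2 : ℤ) with hA
  have hA0 : 0 ≤ A := by positivity
  have hAσ : A * (σ : ℝ) ^ 2 = L * r := by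
    rw [hA, zpow_neg, mul_assoc, zpow_ofNat, inv_mul_cancel₀ (by positivity), mul_one]
  rw [show 1 + 4 * L * r * (σ : ℝ) ^ (-2 : ℤ) = 1 + 4 * A by rw [hA]; ring]
  have hl : 0 ≤ Real.log (1 + 4 * A) := Real.log_nonneg (by linarith)
  -- Chosen so that 2L · r/m ≤ σ²4⁻ⁿ, using Aσ² = Lr; the `+ 1` keeps m positive when A = 0.
  let m : ℕ → ℕ := fun n => ⌊2 * A * 4 ^ n⌋₊ + 1
  have hm (n : ℕ) : 0 < m n := Nat.succ_pos _
  have hm_le (n : ℕ) : (m n : ℝ) ≤ 2 * A * 4 ^ n + 1 := by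
    simp only [m]
    push_cast
    gcongr
    exact Nat.floor_le (by positivity)
  have hm_ge (n : ℕ) : 2 * A * 4 ^ n ≤ m n := by
    simp only [m]
    push_cast
    exact (Nat.lt_floor_add_one _).le
  choose T hT hcard hnet using fun n => exists_net_cube D hr (hm n)
  refine integral_sup'_le_of_nets (fun x => hf.hasSubgaussianMGF ?_) T hT (fun n => ?_)
    (fun n x => ?_) hF
  · exact_mod_cast hmax x
  -- Each level multiplies the bound on m by 4; log 4 ≤ 2 is the source of the term 2D.
  · have hlog4 : Real.log 4 ≤ 2 := by
      rw [show (4 : ℝ) = 2 ^ 2 by norm_num, Real.log_pow]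
      push_cast
      linarith [Real.log_two_lt_d9]
    have hm1 : (m n : ℝ) ≤ 4 ^ n * (1 + 4 * A) := by
      have h4 : (1 : ℝ) ≤ 4 ^ n := one_le_pow₀ (by norm_num)
      nlinarith [hm_le n]
    have hlogm : Real.log (m n) ≤ n * 2 + Real.log (1 + 4 * A) := by
      refine (Real.log_le_log (by exact_mod_cast hm n) hm1).trans ?_
      rw [Real.log_mul (by positivity) (by positivity), Real.log_pow]
      gcongr
    calc Real.log (T n).card ≤ Real.log ((m n : ℝ) ^ D) :=
          Real.log_le_log (by exact_mod_cast (hT n).card_pos) (by exact_mod_cast hcard n)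
      _ = D * Real.log (m n) := Real.log_pow _ _
      _ ≤ D * (n * 2 + Real.log (1 + 4 * A)) := by gcongr
      _ ≤ D * ((n + 1) * (2 + Real.log (1 + 4 * A))) := by
          gcongr
          nlinarith [mul_nonneg (Nat.cast_nonneg (α := ℝ) n) hl]
      _ = _ := by ring
  · obtain ⟨y, hy, hxy⟩ := hnet n x
    refine ⟨y, hy, hf.hasSubgaussianMGF_sub ?_⟩
    have h1 := (le_abs_self _).trans (hLip x y)
    have h2 := (le_abs_self _).trans (hLip y x)
    rw [norm_sub_rev] at h2
    have h3 := mul_le_mul_of_nonneg_left hxy hL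
    have hm0 : (0 : ℝ) < m n := by exact_mod_cast hm n
    have h4 : 2 * (L * (r / m n)) ≤ (σ / 2 ^ n : ℝ) ^ 2 := by
      rw [show 2 * (L * (r / m n)) = 2 * (L * r) / m n by ring, ← hAσ, div_le_iff₀ hm0, div_pow,
        ← pow_mul, mul_comm n 2, pow_mul, show (2 : ℝ) ^ 2 = 4 by norm_num]
      calc 2 * (A * (σ : ℝ) ^ 2) = (σ : ℝ) ^ 2 / 4 ^ n * (2 * A * 4 ^ n) := by field_simp
        _ ≤ (σ : ℝ) ^ 2 / 4 ^ n * m n := by gcongr; exact hm_ge n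
    push_cast
    linarith

theorem mainTheorem5 {Ω : Type*} [MeasurableSpace Ω] (P : Measure Ω) [IsProbabilityMeasure P]
    (D : ℕ) (r : ℝ) (hr : 0 ≤ r)
    (f : cube D r → Ω → ℝ) (k : cube D r → cube D r → ℝ)
    (hf : IsCenteredGP f k P) (hsep : IsSeparableProcess f P)
    (L : ℝ) (hL : 0 ≤ L)
    (hLip : ∀ x x' : cube D r,
      |k x x - k x x'| ≤ L * ‖(x : Fin D → ℝ) - (x' : Fin D → ℝ)‖)
    (σ : ℝ) (hσ : 0 ≤ σ) (hmax : IsGreatest (Set.range fun x : cube D r => k x x) (σ ^ 2)) :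
    (∀ᵐ ω ∂P, BddAbove (Set.range fun x : cube D r => f x ω)) ∧
      Integrable (fun ω => ⨆ x : cube D r, f x ω) P ∧
      ∫ ω, ⨆ x : cube D r, f x ω ∂P
        ≤ 12 * σ * Real.sqrt (2 * D + D * Real.log (1 + 4 * L * r * σ ^ (-2 : ℤ))) := by
  have hmax' (x : cube D r) : k x x ≤ σ ^ 2 := hmax.2 (mem_range_self x)
  have : Nonempty (cube D r) := ⟨⟨0, le_rfl, fun _ => hr⟩⟩
  refine hsep.integral_iSup_le hf.integrable fun F hF => ?_
  lift σ to ℝ≥0 using hσ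
  rcases eq_zero_or_pos σ with rfl | hσ'
  -- Variance proxy 0 bounds the expected maximum by 0; the factor σ = 0 makes the value of `σ ^
  -- (-2)` irrelevant.
  · have := integral_sup'_le_of_hasSubgaussianMGF (P := P) hF (s := 0)
      (fun x _ => hf.hasSubgaussianMGF (by simpa using hmax' x)) le_rfl
    simpa using this
  · refine (hf.integral_sup'_cube_le hr hL hLip hσ' hmax' hF).trans ?_
    set K : ℝ := 2 * D + D * Real.log (1 + 4 * L * r * (σ : ℝ) ^ (-2 : ℤ))
    -- This crude bound suffices: 5√2 ≤ 10 ≤ 12.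
    have h2 : √2 ≤ 2 := by
      rw [Real.sqrt_le_left (by norm_num)]
      norm_num
    rw [Real.sqrt_mul (by norm_num)]
    have hq : 0 ≤ (σ : ℝ) * √K := by positivity
    nlinarith [mul_le_mul_of_nonneg_right h2 hq]
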